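/- Let $\mathcal G=(X,E)$ be a finite connected graph without loop edges or multiple edges, let $T$ be a spanning tree of $\mathcal G$, and let $e_1,\dots,e_r$, $r=|E|-|X|+1$, be an orientation of the edges outside $T$; $-e$ denotes the opposite of an oriented edge $e$. A based loop is a closed path of $\mathcal G$, and a loop is an equivalence class of based loops under the shift of the base point. The fundamental group $\Gamma_x$ is the group of non-backtracking paths from $x$ to $x$, under concatenation followed by erasure of backtracking. It is identified with the free group $\Gamma$ on generators $\gamma_1,\dots,\gamma_r$: the generator $\gamma_i$ corresponds to the path that goes from $x$ to the origin of $e_i$ in $T$, traverses $e_i$, and returns to $x$ in $T$. A loop $l$ thus defines a conjugacy class $C(l)$ of $\Gamma$, namely the class of the element obtained by erasing the backtracking parts of any based loop representing $l$. Let $\Gamma^{(1)}=\Gamma$, $\Gamma^{(n+1)}=[\Gamma^{(n)},\Gamma]$, and $H_n=\Gamma^{(n)}/\Gamma^{(n+1)}$, an abelian group written additively; $h_n:\Gamma^{(n)}\to H_n$ is the projection. The degree $d(l)\in\{1,2,\dots\}\cup\{\infty\}$ is the supremum of the $n\ge1$ with $C(l)\subseteq\Gamma^{(n)}$, and for $n\le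 d(l)$, $h_n(l)\in H_n$ is the common value of $h_n$ on $C(l)$. For $g=\gamma_{j_1}^{n_1}\cdots\gamma_{j_m}^{n_m}\in\Gamma$ let $S(g)=e^{n_1X_{j_1}}\cdots e^{n_mX_{j_m}}$, a real formal series in non-commuting symbols $X_1,\dots,X_r$, and let $P_g$ be the sum of the terms of lowest degree of $S(g)-1$; $P_l$ denotes $P_g$ for $g\in C(l)$. For a based loop $l_\bullet$ and oriented edges $e,f$, let $N_{e,f}(l_\bullet)$ be the number of pairs of times $s<t$ such that $l_\bullet$ crosses $e$ at time $s$ and $f$ at time $t$, and let $\check N_{i,j}=N_{e_i,e_j}+N_{-e_i,-e_j}-N_{e_i,-e_j}-N_{-e_i,e_j}$. Put $[X_i,X_j]=X_iX_j-X_jX_i$ and $[\gamma_i,\gamma_j]=\gamma_i^{-1}\gamma_j^{-1}\gamma_i\gamma_j$. Then for every loop $l$: a) $h_1(l)=0$ if and only if $d(l)\ge2$. In this case, for all $i<j$, the integer $\check N_{i,j}(l_\bullet)-\check N_{j,i}(l_\bullet)$ is the same for all based loops $l_\bullet$ representing $l$, and is denoted $\check N_{i,j}(l)-\check N_{j,i}(l)$;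 these integers vanish for all $i<j$ if and only if $d(l)>2$. b) If $d(l)=2$, then $P_g=\frac12\sum_{1\le i<j\le r}(\check N_{i,j}(l)-\check N_{j,i}(l))[X_i,X_j]$ for every $g\in C(l)$. c) If $d(l)\ge2$, then the integers $\check N_{i,j}(l)-\check N_{j,i}(l)$, $i<j$, are even and $h_2(l)=\sum_{1\le i<j\le r}\frac12(\check N_{i,j}(l)-\check N_{j,i}(l))\,h_2([\gamma_i,\gamma_j])$ in $H_2$. -/

import Mathlib

open SimpleGraph

/-! ### Geodesic reduction of walks and the fundamental group of a graph -/

namespace GraphLoops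

section Reduction

variable {V : Type*} {G : SimpleGraph V}

/-- Non-backtracking (geodesic) walks: no edge is immediately followed by itself, i.e.
`x_{i-1} ≠ x_{i+1}` along the walk. -/
def IsGeodesic {u v : V} (p : G.Walk u v) : Prop := p.edges.IsChain (· ≠ ·)

open Classical in
/-- Put the edge `u → v` in front of a walk starting at `v`, erasing the backtracking that this
creates if the walk starts with the edge `v → u`. -/
noncomputable def rcons : {u v w : V} → G.Adj u v → G.Walk v w → G.Walk u w
  | _, _, _, h, .nil => .cons h .nil
  | u, _, _, h, .cons (v := b) h' q => if e : b = u then q.copy e rfl else .cons h (.cons h' q)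

/-- The geodesic walk obtained from a walk by erasing all its backtracking parts
(the tail of a closed walk is not removed). -/
noncomputable def reduce : {u v : V} → G.Walk u v → G.Walk u v
  | _, _, .nil => .nil
  | _, _, .cons h p => rcons h (reduce p)

@[simp] theorem reduce_nil {u : V} : reduce (.nil : G.Walk u u) = .nil := rfl

@[simp] theorem reduce_cons {u v w : V} (h : G.Adj u v) (p : G.Walk v w) :
    reduce (.cons h p) = rcons h (reduce p) := rfl

theorem IsGeodesic.rcons {u v w : V} (h : G.Adj u v) {p : G.Walk v w} (hp : IsGeodesic p) :
    IsGeodesic (rcons h p) := by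
  cases p with
  | nil => simp [GraphLoops.rcons, IsGeodesic]
  | @cons _ b _ h' q =>
    unfold GraphLoops.rcons
    by_cases e : b = u
    · subst e
      simp only [dite_true, Walk.copy_rfl_rfl]
      exact List.IsChain.tail hp
    · simp only [e, dite_false]
      simp only [IsGeodesic, Walk.edges_cons] at hp ⊢
      rw [List.isChain_cons_cons]
      refine ⟨?_, hp⟩
      intro hh
      rw [Sym2.eq_iff] at hh
      rcases hh with ⟨h1, h2⟩ | ⟨h1, h2⟩
      · exact h.ne h1
      · exact e h1.symm

theorem isGeodesic_reduce {u v : V} (p : G.Walk u v) : IsGeodesic (reduce p) := by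
  induction p with
  | nil => simp [IsGeodesic]
  | cons h p ih => exact ih.rcons h

theorem rcons_of_isGeodesic {u v w : V} (h : G.Adj u v) {p : G.Walk v w}
    (hp : IsGeodesic (.cons h p)) : rcons h p = .cons h p := by
  cases p with
  | nil => rfl
  | @cons _ b _ h' q =>
    have e : b ≠ u := by
      rintro rfl
      simp only [IsGeodesic, Walk.edges_cons, List.isChain_cons_cons] at hp
      exact hp.1 Sym2.eq_swap
    simp [rcons, e]

theorem reduce_of_isGeodesic {u v : V} (p : G.Walk u v) (hp : IsGeodesic p) : reduce p = p := by
  induction p with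
  | nil => rfl
  | cons h p ih =>
    rw [reduce_cons, ih (List.IsChain.tail hp), rcons_of_isGeodesic h hp]

theorem rcons_rcons_symm {u v w : V} (h : G.Adj u v) (h' : G.Adj v u) {p : G.Walk v w}
    (hp : IsGeodesic p) : rcons h' (rcons h p) = p := by
  cases p with
  | nil => simp [rcons]
  | @cons _ b _ k q =>
    by_cases e : b = u
    · subst e
      have : rcons h (.cons k q) = q := by simp [rcons]
      rw [this]
      exact rcons_of_isGeodesic _ hp
    · have : rcons h (.cons k q) = .cons h (.cons k q) := by simp [rcons, e]
      rw [this]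
      simp [rcons]

@[simp] theorem reduce_reduce {u v : V} (p : G.Walk u v) : reduce (reduce p) = reduce p :=
  reduce_of_isGeodesic _ (isGeodesic_reduce p)

theorem reduce_rcons_append {u v w x : V} (h : G.Adj u v) (p : G.Walk v w) (q : G.Walk w x) :
    reduce ((rcons h p).append q) = rcons h (reduce (p.append q)) := by
  cases p with
  | nil => rfl
  | @cons _ b _ k p =>
    by_cases e : b = u
    · subst e
      have : rcons h (.cons k p) = p := by simp [rcons]
      rw [this, Walk.cons_append, reduce_cons,
        rcons_rcons_symm k h (isGeodesic_reduce _)]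
    · have : rcons h (.cons k p) = .cons h (.cons k p) := by simp [rcons, e]
      rw [this]
      rfl

@[simp] theorem reduce_reduce_append {u v w : V} (p : G.Walk u v) (q : G.Walk v w) :
    reduce ((reduce p).append q) = reduce (p.append q) := by
  induction p with
  | nil => rfl
  | cons h p ih => rw [reduce_cons, reduce_rcons_append, ih, Walk.cons_append, reduce_cons]

@[simp] theorem reduce_append_reduce {u v w : V} (p : G.Walk u v) (q : G.Walk v w) :
    reduce (p.append (reduce q)) = reduce (p.append q) := by
  induction p with
  | nil => simp
  | cons h p ih => rw [Walk.cons_append, reduce_cons, ih, Walk.cons_append, reduce_cons]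

theorem reduce_reverse_append_self {u v : V} (p : G.Walk u v) :
    reduce (p.reverse.append p) = .nil := by
  induction p with
  | nil => rfl
  | cons h p ih =>
    rw [Walk.reverse_cons, ← Walk.append_assoc, Walk.cons_append, Walk.nil_append,
      ← reduce_append_reduce, reduce_cons, reduce_cons,
      rcons_rcons_symm h h.symm (isGeodesic_reduce p), reduce_append_reduce, ih]

/-- The fundamental group `Γ_x`, as the set of geodesic based loops with base point `x`. -/
@[ext] structure FundGroup (G : SimpleGraph V) (x : V) where
  /-- the geodesic arc from `x` to `x` -/
  walk : G.Walk x x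
  isGeodesic : IsGeodesic walk

/-- The geodesic based loop homotopic to a based loop. -/
noncomputable def FundGroup.ofWalk {x : V} (p : G.Walk x x) : FundGroup G x :=
  ⟨reduce p, isGeodesic_reduce p⟩

/-- Composition is concatenation followed by erasure of backtracking. -/
noncomputable instance (x : V) : Mul (FundGroup G x) := ⟨fun p q => .ofWalk (p.walk.append q.walk)⟩

noncomputable instance (x : V) : One (FundGroup G x) := ⟨.ofWalk .nil⟩

noncomputable instance (x : V) : Inv (FundGroup G x) := ⟨fun p => .ofWalk p.walk.reverse⟩

theorem FundGroup.ofWalk_mul_ofWalk {x : V} (p q : G.Walk x x) :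
    FundGroup.ofWalk p * FundGroup.ofWalk q = FundGroup.ofWalk (p.append q) := by
  apply FundGroup.ext
  change reduce ((reduce p).append (reduce q)) = reduce (p.append q)
  simp

theorem FundGroup.ofWalk_walk {x : V} (p : FundGroup G x) : FundGroup.ofWalk p.1 = p :=
  FundGroup.ext (reduce_of_isGeodesic p.walk p.isGeodesic)

theorem FundGroup.ofWalk_eq_ofWalk {x : V} {p q : G.Walk x x} :
    FundGroup.ofWalk p = FundGroup.ofWalk q ↔ reduce p = reduce q := FundGroup.ext_iff

noncomputable instance (x : V) : Group (FundGroup G x) :=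
  Group.ofLeftAxioms
    (fun p q r => by
      rw [← p.ofWalk_walk, ← q.ofWalk_walk, ← r.ofWalk_walk]
      simp only [FundGroup.ofWalk_mul_ofWalk, Walk.append_assoc])
    (fun p => by
      rw [← p.ofWalk_walk]
      change FundGroup.ofWalk .nil * _ = _
      rw [FundGroup.ofWalk_mul_ofWalk, Walk.nil_append])
    (fun p => by
      change FundGroup.ofWalk p.walk.reverse * p = FundGroup.ofWalk .nil
      conv_lhs => enter [2]; rw [← p.ofWalk_walk]
      rw [FundGroup.ofWalk_mul_ofWalk, FundGroup.ofWalk_eq_ofWalk]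
      rw [reduce_reverse_append_self, reduce_nil])

theorem FundGroup.ofWalk_nil (x : V) : FundGroup.ofWalk (.nil : G.Walk x x) = 1 := rfl

theorem rcons_mapLe {T : SimpleGraph V} (hT : T ≤ G) {u v w : V} (h : T.Adj u v)
    (p : T.Walk v w) : rcons (hT h) (p.mapLe hT) = (rcons h p).mapLe hT := by
  cases p with
  | nil => rfl
  | @cons _ b _ k q =>
    by_cases e : b = u
    · subst e
      simp [rcons]
    · simp [rcons, e]

theorem reduce_mapLe {T : SimpleGraph V} (hT : T ≤ G) {u v : V} (p : T.Walk u v) :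
    reduce (p.mapLe hT) = (reduce p).mapLe hT := by
  induction p with
  | nil => rfl
  | cons h p ih =>
    rw [reduce_cons, ← rcons_mapLe, ← ih]
    rfl

theorem reduce_mapLe_closed {T : SimpleGraph V} (hT : T ≤ G) (ha : T.IsAcyclic) {u : V}
    (p : T.Walk u u) : reduce (p.mapLe hT) = .nil := by
  rw [reduce_mapLe]
  have : (reduce p).IsPath := (ha.isPath_iff_isChain _).2 (isGeodesic_reduce p)
  rw [(Walk.isPath_iff_nil.1 this).eq_nil]
  rfl

end Reduction

/-! ### Spanning trees and the identification of the fundamental groups with a free group -/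

/-- A spanning tree `T` of the graph `G` (which is therefore connected) together with an
orientation `e 1, …, e r` of the edges of `G` outside `T`, each of which is listed exactly once
(for a finite graph, this forces `r = |E| - |V| + 1`). -/
structure TreeFrame {V : Type*} (G : SimpleGraph V) (r : ℕ) where
  /-- the spanning tree -/
  T : SimpleGraph V
  le : T ≤ G
  isTree : T.IsTree
  /-- the oriented edges outside the tree -/
  e : Fin r → G.Dart
  edge_notMem : ∀ i, (e i).edge ∉ T.edgeSet
  edge_injective : Function.Injective fun i => (e i).edge
  edge_surjective : ∀ a ∈ G.edgeSet, a ∉ T.edgeSet → ∃ i, (e i).edge = a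

namespace TreeFrame

variable {V : Type*} {G : SimpleGraph V} {r : ℕ} (B : TreeFrame G r)

/-- The geodesic from `u` to `v` in the spanning tree. -/
noncomputable def geod (u v : V) : G.Walk u v :=
  ((B.isTree.existsUnique_path u v).choose).mapLe B.le

/-- The element `γ_x(a)` of `Γ_x`: go from `x` to the origin of `a` in the tree, traverse `a`, and
come back to `x` in the tree. -/
noncomputable def gammaAt (x : V) (a : G.Dart) : FundGroup G x :=
  .ofWalk ((B.geod x a.fst).append (.cons a.adj (B.geod a.snd x)))

open Classical in
/-- The letter of the free group attached to an oriented edge: the `i`-th generator for `e i`, its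
inverse for the opposite edge, and `1` for the edges of the tree. -/
noncomputable def letter (a : G.Dart) : FreeGroup (Fin r) :=
  if h : ∃ i, B.e i = a then FreeGroup.of h.choose
  else if h : ∃ i, B.e i = a.symm then (FreeGroup.of h.choose)⁻¹
  else 1

theorem e_injective : Function.Injective B.e := fun _ _ h =>
  B.edge_injective (congrArg Dart.edge h)

theorem e_ne_symm (i j : Fin r) : B.e i ≠ (B.e j).symm := by
  intro h
  have hij : i = j := B.edge_injective (by simp [h])
  subst hij
  exact (B.e i).symm_ne h.symm

theorem letter_e (i : Fin r) : B.letter (B.e i) = FreeGroup.of i := by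
  have h : ∃ j, B.e j = B.e i := ⟨i, rfl⟩
  rw [letter, dif_pos h, B.e_injective h.choose_spec]

theorem letter_e_symm (i : Fin r) : B.letter (B.e i).symm = (FreeGroup.of i)⁻¹ := by
  have h0 : ¬ ∃ j, B.e j = (B.e i).symm := fun ⟨j, hj⟩ => B.e_ne_symm j i hj
  have h : ∃ j, B.e j = (B.e i).symm.symm := ⟨i, by simp⟩
  have h2 : h.choose = i := B.e_injective (by simpa using h.choose_spec)
  rw [letter, dif_neg h0, dif_pos h, h2]

theorem letter_tree {a : G.Dart} (ha : a.edge ∈ B.T.edgeSet) : B.letter a = 1 := by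
  have h0 : ¬ ∃ j, B.e j = a := by
    rintro ⟨j, rfl⟩
    exact B.edge_notMem j ha
  have h1 : ¬ ∃ j, B.e j = a.symm := by
    rintro ⟨j, hj⟩
    exact B.edge_notMem j (by rw [hj]; simpa using ha)
  rw [letter, dif_neg h0, dif_neg h1]

theorem dart_cases (a : G.Dart) :
    a.edge ∈ B.T.edgeSet ∨ (∃ i, a = B.e i) ∨ ∃ i, a = (B.e i).symm := by
  by_cases ha : a.edge ∈ B.T.edgeSet
  · exact .inl ha
  · obtain ⟨i, hi⟩ := B.edge_surjective _ a.edge_mem ha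
    rcases dart_edge_eq_iff _ _ |>.1 hi with h | h
    · exact .inr (.inl ⟨i, h.symm⟩)
    · exact .inr (.inr ⟨i, by rw [h]; simp⟩)

theorem letter_symm (a : G.Dart) : B.letter a.symm = (B.letter a)⁻¹ := by
  rcases B.dart_cases a with h | ⟨i, rfl⟩ | ⟨i, rfl⟩
  · rw [B.letter_tree h, B.letter_tree (by simpa using h), inv_one]
  · rw [letter_e, letter_e_symm]
  · rw [letter_e_symm, Dart.symm_symm, letter_e, inv_inv]

/-- The product of the letters of the edges traversed by a walk. -/
noncomputable def word {u v : V} (p : G.Walk u v) : FreeGroup (Fin r) :=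
  (p.darts.map B.letter).prod

@[simp] theorem word_nil {u : V} : B.word (.nil : G.Walk u u) = 1 := rfl

@[simp] theorem word_cons {u v w : V} (h : G.Adj u v) (p : G.Walk v w) :
    B.word (.cons h p) = B.letter ⟨(u, v), h⟩ * B.word p := by simp [word]

@[simp] theorem word_append {u v w : V} (p : G.Walk u v) (q : G.Walk v w) :
    B.word (p.append q) = B.word p * B.word q := by simp [word]

theorem word_rcons {u v w : V} (h : G.Adj u v) (p : G.Walk v w) :
    B.word (rcons h p) = B.letter ⟨(u, v), h⟩ * B.word p := by
  cases p with
  | nil => simp [rcons]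
  | @cons _ b _ k q =>
    by_cases e : b = u
    · subst e
      have h1 : rcons h (.cons k q) = q := by simp [rcons]
      have h2 : B.letter ⟨(v, b), k⟩ = (B.letter ⟨(b, v), h⟩)⁻¹ := B.letter_symm ⟨(b, v), h⟩
      rw [h1, word_cons, h2, mul_inv_cancel_left]
    · have h1 : rcons h (.cons k q) = .cons h (.cons k q) := by simp [rcons, e]
      rw [h1, word_cons]

@[simp] theorem word_reduce {u v : V} (p : G.Walk u v) : B.word (reduce p) = B.word p := by
  induction p with
  | nil => rfl
  | cons h p ih => rw [reduce_cons, word_rcons, ih, word_cons]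

theorem word_mapLe {u v : V} (p : B.T.Walk u v) : B.word (p.mapLe B.le) = 1 := by
  induction p with
  | nil => rfl
  | cons h p ih =>
    rw [Walk.mapLe, Walk.map_cons, word_cons, ih, mul_one]
    exact B.letter_tree h

/-- The walk `p` from `u` to `v`, closed up at `x` by geodesics of the tree. -/
noncomputable def closeUp (x : V) {u v : V} (p : G.Walk u v) : FundGroup G x :=
  .ofWalk ((B.geod x u).append (p.append (B.geod v x)))

theorem closeUp_mapLe (x : V) {u v : V} (p : B.T.Walk u v) :
    B.closeUp x (p.mapLe B.le) = 1 := by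
  rw [← FundGroup.ofWalk_nil, closeUp, FundGroup.ofWalk_eq_ofWalk]
  simp only [geod, ← Walk.mapLe_append]
  rw [reduce_mapLe_closed B.le B.isTree.isAcyclic, reduce_nil]

theorem closeUp_append (x : V) {u v w : V} (p : G.Walk u v) (q : G.Walk v w) :
    B.closeUp x (p.append q) = B.closeUp x p * B.closeUp x q := by
  rw [closeUp, closeUp, closeUp, FundGroup.ofWalk_mul_ofWalk, FundGroup.ofWalk_eq_ofWalk]
  have h : reduce ((B.geod v x).append (B.geod x v)) = .nil := by
    simp only [geod, ← Walk.mapLe_append]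
    exact reduce_mapLe_closed B.le B.isTree.isAcyclic _
  have h2 : reduce ((B.geod v x).append ((B.geod x v).append (q.append (B.geod w x)))) =
      reduce (q.append (B.geod w x)) := by
    rw [Walk.append_assoc, ← reduce_reduce_append, h, Walk.nil_append]
  simp only [← Walk.append_assoc]
  have h3 : reduce (p.append (q.append (B.geod w x))) =
      reduce (p.append ((B.geod v x).append ((B.geod x v).append (q.append (B.geod w x))))) := by
    rw [← reduce_append_reduce, ← h2, reduce_append_reduce]
  rw [← reduce_append_reduce, h3, reduce_append_reduce]

theorem closeUp_congr (x : V) {u v : V} {p q : G.Walk u v} (h : reduce p = reduce q) :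
    B.closeUp x p = B.closeUp x q := by
  rw [closeUp, closeUp, FundGroup.ofWalk_eq_ofWalk, ← reduce_append_reduce, ← reduce_reduce_append p, h,
    reduce_reduce_append, reduce_append_reduce]

theorem closeUp_dart (x : V) (a : G.Dart) : B.closeUp x (.cons a.adj .nil) = B.gammaAt x a := rfl

theorem gammaAt_symm (x : V) (a : G.Dart) : B.gammaAt x a.symm = (B.gammaAt x a)⁻¹ := by
  rw [eq_inv_iff_mul_eq_one, ← closeUp_dart, ← closeUp_dart]
  refine (B.closeUp_append x _ _).symm.trans ?_
  refine (B.closeUp_congr x (q := .nil) ?_).trans (B.closeUp_mapLe x .nil)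
  exact reduce_reverse_append_self (.cons a.adj .nil)

theorem lift_word (x : V) {u v : V} (p : G.Walk u v) :
    FreeGroup.lift (fun i => B.gammaAt x (B.e i)) (B.word p) = B.closeUp x p := by
  induction p with
  | nil => rw [word_nil, map_one]; exact (B.closeUp_mapLe x .nil).symm
  | @cons u v w h p ih =>
    have key : ∀ a : G.Dart, FreeGroup.lift (fun i => B.gammaAt x (B.e i)) (B.letter a) =
        B.gammaAt x a := by
      intro a
      rcases B.dart_cases a with ha | ⟨i, rfl⟩ | ⟨i, rfl⟩
      · rw [B.letter_tree ha, map_one]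
        exact (B.closeUp_mapLe x (.cons (show B.T.Adj a.fst a.snd from ha) .nil)).symm
      · rw [letter_e, FreeGroup.lift_apply_of]
      · rw [letter_e_symm, map_inv, FreeGroup.lift_apply_of, gammaAt_symm]
    rw [word_cons, map_mul, ih, key]
    exact (B.closeUp_append x (.cons h .nil) p).symm

theorem word_gammaAt (x : V) (i : Fin r) : B.word (B.gammaAt x (B.e i)).walk = FreeGroup.of i := by
  change B.word (reduce _) = _
  rw [word_reduce, word_append, word_cons, geod, geod, word_mapLe, word_mapLe, one_mul, mul_one]
  exact B.letter_e i

/-- The isomorphism between `Γ_x` and the free group on `r` generators that is determined by the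
spanning tree: it maps `γ_x(e i)` to the `i`-th generator. -/
noncomputable def equivFree (x : V) : FundGroup G x ≃* FreeGroup (Fin r) where
  toFun p := B.word p.walk
  invFun := FreeGroup.lift fun i => B.gammaAt x (B.e i)
  left_inv p := by
    change FreeGroup.lift _ (B.word p.walk) = p
    rw [lift_word]
    have h0 : B.geod x x = .nil := by
      have : (B.isTree.existsUnique_path x x).choose.IsPath :=
        (B.isTree.existsUnique_path x x).choose_spec.1
      rw [geod, (Walk.isPath_iff_nil.1 this).eq_nil]
      rfl
    rw [closeUp, h0, Walk.nil_append, Walk.append_nil, FundGroup.ofWalk_walk]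
  right_inv g := by
    let φ : FundGroup G x →* FreeGroup (Fin r) :=
      MonoidHom.mk' (fun p => B.word p.walk) fun p q => by
        change B.word (reduce _) = _
        rw [word_reduce, word_append]
    have h : φ.comp (FreeGroup.lift fun i => B.gammaAt x (B.e i)) = MonoidHom.id _ :=
      FreeGroup.ext_hom _ _ fun i => by
        rw [MonoidHom.comp_apply, FreeGroup.lift_apply_of]
        exact B.word_gammaAt x i
    exact DFunLike.congr_fun h g
  map_mul' p q := by
    change B.word (reduce _) = _
    rw [word_reduce, word_append]

theorem equivFree_gammaAt (x : V) (i : Fin r) :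
    B.equivFree x (B.gammaAt x (B.e i)) = FreeGroup.of i := B.word_gammaAt x i

end TreeFrame

/-! ### Based loops and loops -/

section Loops

variable {V : Type*}

/-- Based loops: walks from a vertex to itself. -/
structure BasedLoop (G : SimpleGraph V) where
  /-- the base point -/
  base : V
  /-- the walk from the base point to itself -/
  walk : G.Walk base base

variable {G : SimpleGraph V}

/-- The shift: the first edge is moved to the end. -/
def BasedLoop.shift : BasedLoop G → BasedLoop G
  | ⟨x, .nil⟩ => ⟨x, .nil⟩
  | ⟨_, .cons (v := y) h p⟩ => ⟨y, p.append (.cons h .nil)⟩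

/-- Loops: based loops up to the equivalence relation generated by the shift. -/
def Loop (G : SimpleGraph V) : Type _ := Quot fun l l' : BasedLoop G => l.shift = l'

/-- The based loop `b` represents the loop `l`. -/
def BasedLoop.Represents (b : BasedLoop G) (l : Loop G) : Prop := Quot.mk _ b = l

/-- `N_{a,b}`: the number of pairs of times `s < t` such that the based loop crosses the oriented
edge `a` at time `s` and the oriented edge `b` at time `t`. -/
noncomputable def BasedLoop.crossings (l : BasedLoop G) (a b : G.Dart) : ℕ :=
  Nat.card {t : Fin l.walk.darts.length × Fin l.walk.darts.length //
    t.1 < t.2 ∧ l.walk.darts.get t.1 = a ∧ l.walk.darts.get t.2 = b}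

end Loops

/-! ### Lower central series, degree and homology classes -/

section LowerCentral

variable (Γ : Type*) [Group Γ]

/-- The lower central series, indexed so that `lcs Γ 1 = Γ` and `lcs Γ (n + 1) = [lcs Γ n, Γ]` for
`1 ≤ n`. (Index `0` is not used.) -/
def lcs (n : ℕ) : Subgroup Γ := (⊤ : Subgroup Γ).lowerCentralSeries (n - 1)

theorem lcs_antitone : Antitone (lcs Γ) := fun _ _ h =>
  Subgroup.lowerCentralSeries_antitone _ (Nat.sub_le_sub_right h 1)

instance lcs_normal (n : ℕ) : (lcs Γ n).Normal := by
  unfold lcs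
  infer_instance

theorem commutator_lcs_le (n : ℕ) : ⁅lcs Γ n, (⊤ : Subgroup Γ)⁆ ≤ lcs Γ (n + 1) := by
  cases n with
  | zero => exact le_top
  | succ n => exact le_refl _

/-- `H_n = Γ^(n) / Γ^(n+1)`, written additively. -/
abbrev HGroup (n : ℕ) : Type _ := Additive (lcs Γ n ⧸ (lcs Γ (n + 1)).subgroupOf (lcs Γ n))

instance (n : ℕ) : AddCommGroup (HGroup Γ n) :=
  { (inferInstance : AddGroup (HGroup Γ n)) with
    add_comm := by
      intro a b
      induction a using Additive.rec with | _ a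
      induction b using Additive.rec with | _ b
      induction a using QuotientGroup.induction_on with | _ a
      induction b using QuotientGroup.induction_on with | _ b
      refine congrArg Additive.ofMul (QuotientGroup.eq.2 ?_)
      rw [Subgroup.mem_subgroupOf]
      have h := commutator_lcs_le Γ n (Subgroup.commutator_mem_commutator
        ((lcs Γ n).inv_mem b.2) (Subgroup.mem_top (a.1⁻¹)))
      simpa [commutatorElement_def, mul_assoc] using h }

variable {Γ}

/-- The class `h_n(u)` in `H_n` of an element `u` of `Γ^(n)`. -/
def hcls (n : ℕ) (u : lcs Γ n) : HGroup Γ n := Additive.ofMul (QuotientGroup.mk u)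

theorem hcls_eq_of_isConj {n : ℕ} {u v : lcs Γ n} (h : IsConj u.1 v.1) :
    hcls n u = hcls n v := by
  obtain ⟨c, hc⟩ := isConj_iff.1 h
  refine congrArg Additive.ofMul (QuotientGroup.eq.2 ?_)
  rw [Subgroup.mem_subgroupOf]
  have h := commutator_lcs_le Γ n (Subgroup.commutator_mem_commutator
        ((lcs Γ n).inv_mem u.2) (Subgroup.mem_top c))
  simpa [commutatorElement_def, ← hc, mul_assoc] using h

/-- The degree of a conjugacy class: the highest `n ≥ 1` such that it is included in `Γ^(n)`
(`⊤` if it is included in all of them). -/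
noncomputable def degree (c : ConjClasses Γ) : ℕ∞ :=
  ⨆ n ∈ {n : ℕ | 1 ≤ n ∧ c.carrier ⊆ lcs Γ n}, (n : ℕ∞)

theorem mem_lcs_of_le_degree {c : ConjClasses Γ} {n : ℕ} (h : n ≤ degree c) {u : Γ}
    (hu : ConjClasses.mk u = c) : u ∈ lcs Γ n := by
  by_contra hn
  have h1 : degree c ≤ (n - 1 : ℕ) := by
    refine iSup₂_le fun m hm => ?_
    have : m < n := by
      by_contra hmn
      exact hn (lcs_antitone Γ (not_lt.1 hmn) (hm.2 (ConjClasses.mem_carrier_iff_mk_eq.2 hu)))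
    exact_mod_cast Nat.le_sub_one_of_lt this
  have h0 : n ≠ 0 := by
    rintro rfl
    exact hn (Subgroup.mem_top u)
  have := h.trans h1
  rw [Nat.cast_le] at this
  omega

theorem one_le_degree (c : ConjClasses Γ) : ((1 : ℕ) : ℕ∞) ≤ degree c :=
  le_iSup₂_of_le (f := fun (n : ℕ) (_ : n ∈ {n : ℕ | 1 ≤ n ∧ c.carrier ⊆ lcs Γ n}) => (n : ℕ∞)) 1
    ⟨le_refl 1, fun u _ => Subgroup.mem_top u⟩ (le_refl _)

/-- The class in `H_n` of a conjugacy class included in `Γ^(n)`. -/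
noncomputable def hclass (n : ℕ) (c : ConjClasses Γ) (h : n ≤ degree c) : HGroup Γ n :=
  hcls n ⟨c.exists_rep.choose, mem_lcs_of_le_degree h c.exists_rep.choose_spec⟩

/-- The class `h_n` of a conjugacy class can be computed on any of its elements. -/
theorem hclass_eq {n : ℕ} {c : ConjClasses Γ} (h : n ≤ degree c) {u : Γ}
    (hu : ConjClasses.mk u = c) : hclass n c h = hcls n ⟨u, mem_lcs_of_le_degree h hu⟩ :=
  hcls_eq_of_isConj (ConjClasses.mk_eq_mk_iff_isConj.1 (c.exists_rep.choose_spec.trans hu.symm))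

/-- The commutator `u⁻¹ v⁻¹ u v`, as an element of `Γ^(2)`. -/
def comm2 (u v : Γ) : lcs Γ 2 :=
  ⟨u⁻¹ * v⁻¹ * u * v, by
    have h := commutator_lcs_le Γ 1 (Subgroup.commutator_mem_commutator
      (Subgroup.mem_top u⁻¹ : u⁻¹ ∈ lcs Γ 1) (Subgroup.mem_top v⁻¹))
    simpa [commutatorElement_def] using h⟩

end LowerCentral

/-! ### Formal series in non-commuting symbols and the discrete signature -/

section Series

/-- Real formal series in the non-commuting symbols `X_i`, `i : Fin r`, given by the coefficient
of each word. -/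
def NCSeries (r : ℕ) : Type := List (Fin r) → ℝ

variable {r : ℕ}

instance : AddCommGroup (NCSeries r) := inferInstanceAs (AddCommGroup (List (Fin r) → ℝ))

noncomputable instance : Module ℝ (NCSeries r) := inferInstanceAs (Module ℝ (List (Fin r) → ℝ))

instance : One (NCSeries r) := ⟨fun w => if w = [] then 1 else 0⟩

/-- Multiplication of formal series: words are multiplied by concatenation. -/
noncomputable instance : Mul (NCSeries r) :=
  ⟨fun f g w => ∑ k ∈ Finset.range (w.length + 1), f (w.take k) * g (w.drop k)⟩

/-- The symbol `X_i`. -/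
def NCSeries.X (i : Fin r) : NCSeries r := fun w => if w = [i] then 1 else 0

/-- The exponential series `e^{n X_i} = ∑ k, (n ^ k / k!) X_i ^ k`. -/
noncomputable def NCSeries.expX (i : Fin r) (n : ℤ) : NCSeries r := fun w =>
  if w = List.replicate w.length i then (n : ℝ) ^ w.length / (w.length.factorial : ℝ) else 0

/-- The sum of the terms of lowest degree of a series. -/
noncomputable def NCSeries.lowest (f : NCSeries r) : NCSeries r := fun w =>
  open Classical in if ∀ v : List (Fin r), v.length < w.length → f v = 0 then f w else 0

/-- The signature `S(g)` of an element `γ_{j_1}^{n_1} ⋯ γ_{j_m}^{n_m}` of the free group: the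
product `e^{n_1 X_{j_1}} ⋯ e^{n_m X_{j_m}}`. (The reduced word is written with exponents `±1`.) -/
noncomputable def signature (g : FreeGroup (Fin r)) : NCSeries r :=
  (g.toWord.map fun a => NCSeries.expX a.1 (if a.2 then 1 else -1)).prod

/-- `P_g`: the sum of the terms of lowest degree in `S(g) - 1`. -/
noncomputable def lowestPoly (g : FreeGroup (Fin r)) : NCSeries r := (signature g - 1).lowest

end Series

/-! ### The invariants of a loop -/

namespace TreeFrame

variable {V : Type*} {G : SimpleGraph V} {r : ℕ} (B : TreeFrame G r)

/-- The element of the free group that corresponds to the geodesic based loop homotopic to a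
based loop. -/
noncomputable def elt (l : BasedLoop G) : FreeGroup (Fin r) :=
  B.equivFree l.base (FundGroup.ofWalk l.walk)

theorem elt_eq_word (l : BasedLoop G) : B.elt l = B.word l.walk := B.word_reduce l.walk

/-- The conjugacy class of the free group that corresponds to a loop `l`, i.e. to the geodesic loop
homotopic to `l`. It is the class of the geodesic based loop homotopic to any based loop that
represents `l` (the tail that the latter may have only amounts to a conjugation). -/
noncomputable def conjClass : Loop G → ConjClasses (FreeGroup (Fin r)) :=
  Quot.lift (fun l => ConjClasses.mk (B.elt l)) <| by
    rintro ⟨x, p⟩ _ rfl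
    rw [ConjClasses.mk_eq_mk_iff_isConj, elt_eq_word, elt_eq_word]
    cases p with
    | nil => exact IsConj.refl _
    | cons h p =>
      refine isConj_iff.2 ⟨(B.letter ⟨(_, _), h⟩)⁻¹, ?_⟩
      simp [BasedLoop.shift]

/-- The degree `d(l)`. -/
noncomputable def loopDegree (l : Loop G) : ℕ∞ := degree (B.conjClass l)

/-- The homology class `h_n(l)`, for `n ≤ d(l)`. -/
noncomputable def loopH (n : ℕ) (l : Loop G) (h : n ≤ B.loopDegree l) :
    HGroup (FreeGroup (Fin r)) n := hclass n (B.conjClass l) h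

/-- `Ň_{i,j}` for a based loop. -/
noncomputable def crossN (b : BasedLoop G) (i j : Fin r) : ℤ :=
  b.crossings (B.e i) (B.e j) + b.crossings (B.e i).symm (B.e j).symm
    - b.crossings (B.e i) (B.e j).symm - b.crossings (B.e i).symm (B.e j)

end TreeFrame

end GraphLoops

/-! Everything is read off from the word `g` of a based loop in the free group, through the
homomorphism `incrArea` to a Heisenberg-type group. It records the exponent sums `incr` and the
matrix `area`, twice the Lévy area of the lattice path spelled by `g`.

Crossings: prepending a letter changes the area by its increment times the signed count of the later
letters, antisymmetrized. Summing over letters gives `area_elt`, which equates the area with the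
antisymmetrized crossing number. Conjugation changes the area only by terms linear in `incr g`, so
the area is a loop invariant once `incr g = 0`.

Lower central series: `incr` detects `Γ^(2)` (`mem_lcs_two_iff`). On `Γ^(2)` the area is additive,
and on a commutator of `u` and `v` it is twice the 2×2 minors of the two increments. These minors
are also the coefficients of the class in `H_2`, as the bracket is bilinear and alternating. This
gives the parity and the formula for `h_2` (`even_area_and_hcls_two`), hence also the criterion for
`Γ^(3)` (`mem_lcs_three_iff`).

Signature: its coefficients of order one and two are polynomials in `incr` and `area`
(`prod_expX_apply`), and only half the area survives when `incr` vanishes (`lowestPoly_eq`). -/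

namespace GraphLoops

/-! ### The free nilpotent group of class two, through its Lévy area -/

/-- Pairs of an integral vector and an integral matrix, multiplied like the increment and twice the
Lévy area of concatenated lattice paths. -/
@[ext] structure AreaGroup (r : ℕ) where
  /-- the increment -/
  incr : Fin r → ℤ
  /-- twice the Lévy area -/
  area : Fin r → Fin r → ℤ

namespace AreaGroup

variable {r : ℕ}

instance : Mul (AreaGroup r) := ⟨fun p q =>
  ⟨fun i => p.incr i + q.incr i,
    fun i j => p.area i j + q.area i j + (p.incr i * q.incr j - p.incr j * q.incr i)⟩⟩

instance : One (AreaGroup r) := ⟨⟨fun _ => 0, fun _ _ => 0⟩⟩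

/-- The cross term of an increment with its own opposite vanishes, so negating both components
suffices. -/
instance : Inv (AreaGroup r) := ⟨fun p => ⟨fun i => -p.incr i, fun i j => -p.area i j⟩⟩

@[simp] theorem incr_mul (p q : AreaGroup r) (i : Fin r) :
    (p * q).incr i = p.incr i + q.incr i := rfl

@[simp] theorem area_mul (p q : AreaGroup r) (i j : Fin r) : (p * q).area i j =
    p.area i j + q.area i j + (p.incr i * q.incr j - p.incr j * q.incr i) := rfl

@[simp] theorem incr_one (i : Fin r) : (1 : AreaGroup r).incr i = 0 := rfl

@[simp] theorem area_one (i j : Fin r) : (1 : AreaGroup r).area i j = 0 := rfl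

@[simp] theorem incr_inv (p : AreaGroup r) (i : Fin r) : p⁻¹.incr i = -p.incr i := rfl

@[simp] theorem area_inv (p : AreaGroup r) (i j : Fin r) : p⁻¹.area i j = -p.area i j := rfl

instance : Group (AreaGroup r) :=
  Group.ofLeftAxioms
    (fun p q s => by ext <;> simp <;> ring)
    (fun p => by ext <;> simp)
    (fun p => by ext <;> simp [mul_comm])

end AreaGroup

variable {r : ℕ}

/-- The increment and twice the Lévy area of the lattice path described by a word. -/
def incrArea : FreeGroup (Fin r) →* AreaGroup r :=
  FreeGroup.lift fun i => ⟨Pi.single i 1, fun _ _ => 0⟩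

/-- The exponent sum of the `i`-th generator. -/
def incr (g : FreeGroup (Fin r)) (i : Fin r) : ℤ := (incrArea g).incr i

/-- Twice the Lévy area in the plane of the `i`-th and the `j`-th generator. -/
def area (g : FreeGroup (Fin r)) (i j : Fin r) : ℤ := (incrArea g).area i j

theorem incr_of (i j : Fin r) :
    incr (FreeGroup.of i) j = (Pi.single i 1 : Fin r → ℤ) j := by
  simp [incr, incrArea]

theorem area_of (k i j : Fin r) : area (FreeGroup.of k) i j = 0 := by
  simp [area, incrArea]

@[simp] theorem incr_one (i : Fin r) : incr 1 i = 0 := by simp [incr]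

@[simp] theorem area_one (i j : Fin r) : area 1 i j = 0 := by simp [area]

@[simp] theorem incr_mul (g h : FreeGroup (Fin r)) (i : Fin r) :
    incr (g * h) i = incr g i + incr h i := by simp [incr]

@[simp] theorem area_mul (g h : FreeGroup (Fin r)) (i j : Fin r) : area (g * h) i j =
    area g i j + area h i j + (incr g i * incr h j - incr g j * incr h i) := by
  simp [area, incr]

@[simp] theorem incr_inv (g : FreeGroup (Fin r)) (i : Fin r) : incr g⁻¹ i = -incr g i := by
  simp [incr]

@[simp] theorem area_inv (g : FreeGroup (Fin r)) (i j : Fin r) :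
    area g⁻¹ i j = -area g i j := by simp [area]

theorem incr_eq_of_isConj {g h : FreeGroup (Fin r)} (H : IsConj g h) (i : Fin r) :
    incr h i = incr g i := by
  obtain ⟨c, rfl⟩ := isConj_iff.1 H
  simp

/-- Conjugation by `c` adds `2 * (incr c i * incr g j - incr c j * incr g i)` to the area. -/
theorem area_eq_of_isConj {g h : FreeGroup (Fin r)} (H : IsConj g h) (h0 : ∀ i, incr g i = 0)
    (i j : Fin r) : area h i j = area g i j := by
  obtain ⟨c, rfl⟩ := isConj_iff.1 H
  simp [h0]
  ring

/-! ### The first two quotients of the lower central series of the free group -/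

section LowerCentral

variable {Γ : Type*} [Group Γ]

theorem hcls_mul {n : ℕ} (u v : lcs Γ n) : hcls n (u * v) = hcls n u + hcls n v := rfl

theorem hcls_one (n : ℕ) : hcls n (1 : lcs Γ n) = 0 := rfl

theorem hcls_inv {n : ℕ} (u : lcs Γ n) : hcls n u⁻¹ = -hcls n u := rfl

theorem hcls_eq_zero_iff {n : ℕ} (u : lcs Γ n) : hcls n u = 0 ↔ u.1 ∈ lcs Γ (n + 1) := by
  rw [← Subgroup.mem_subgroupOf]
  exact QuotientGroup.eq_one_iff u

/-- The bracket of `H_1` with values in `H_2`. -/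
def bracket (u v : Γ) : HGroup Γ 2 := hcls 2 (comm2 u v)

theorem bracket_swap (u v : Γ) : bracket v u = -bracket u v := by
  rw [bracket, bracket, ← hcls_inv]
  congr 1
  ext
  simp [comm2, mul_assoc]

theorem bracket_self (u : Γ) : bracket u u = 0 := by
  rw [bracket, ← hcls_one]
  congr 1
  ext
  simp [comm2]

/-- With this convention `[u, vv'] = [u, v'] · v'⁻¹[u, v]v'`, and the conjugation by `v'` is
invisible in `H_2`. -/
theorem bracket_mul_right (u v v' : Γ) :
    bracket u (v * v') = bracket u v + bracket u v' := by
  have h : bracket u v = hcls 2 ⟨v'⁻¹ * (comm2 u v).1 * v'⁻¹⁻¹,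
      (lcs_normal Γ 2).conj_mem _ (comm2 u v).2 _⟩ :=
    hcls_eq_of_isConj (isConj_iff.2 ⟨v'⁻¹, rfl⟩)
  rw [add_comm, h, bracket, bracket, ← hcls_mul]
  congr 1
  ext
  simp [comm2, mul_assoc]

theorem bracket_mul_left (u u' v : Γ) :
    bracket (u * u') v = bracket u v + bracket u' v := by
  rw [bracket_swap, bracket_mul_right, bracket_swap, bracket_swap u']
  abel

/-- Normality of the lower central series reduces a condition on a whole conjugacy class to one
representative. -/
theorem natCast_le_degree_mk {n : ℕ} (hn : 1 ≤ n) (g : Γ) :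
    (n : ℕ∞) ≤ degree (ConjClasses.mk g) ↔ g ∈ lcs Γ n := by
  refine ⟨fun h => mem_lcs_of_le_degree h rfl, fun h => ?_⟩
  refine le_iSup₂_of_le (f := fun (n : ℕ)
    (_ : n ∈ {n : ℕ | 1 ≤ n ∧ (ConjClasses.mk g).carrier ⊆ lcs Γ n}) => (n : ℕ∞)) n
    ⟨hn, fun u hu => ?_⟩ le_rfl
  rw [ConjClasses.mem_carrier_iff_mk_eq, ConjClasses.mk_eq_mk_iff_isConj] at hu
  obtain ⟨c, hc⟩ := isConj_iff.1 hu.symm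
  rw [← hc]
  exact (lcs_normal Γ n).conj_mem _ h _

end LowerCentral

/-- Such a map is a homomorphism to an abelian group, so its values on generators determine it. It
is applied to `h_1` and to the bracket in each variable. -/
theorem map_eq_sum_incr {A : Type*} [AddCommGroup A] (f : FreeGroup (Fin r) → A)
    (hf : ∀ g h, f (g * h) = f g + f h) (g : FreeGroup (Fin r)) :
    f g = ∑ i, incr g i • f (FreeGroup.of i) := by
  let φ : FreeGroup (Fin r) →* Multiplicative A := MonoidHom.mk' (fun g => .ofAdd (f g)) hf
  let ψ : FreeGroup (Fin r) →* Multiplicative A :=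
    MonoidHom.mk' (fun g => .ofAdd (∑ i, incr g i • f (FreeGroup.of i))) fun g h => by
      simp [add_smul, Finset.sum_add_distrib]
  have : φ = ψ := FreeGroup.ext_hom _ _ fun k => by
    change Multiplicative.ofAdd _ = Multiplicative.ofAdd _
    simp [incr_of, Pi.single_apply]
  exact congrArg Multiplicative.toAdd (DFunLike.congr_fun this g)

theorem sum_sum_eq_sum_Ioi {A : Type*} [AddCommGroup A] (F : Fin r → Fin r → A)
    (h0 : ∀ i, F i i = 0) :
    ∑ i, ∑ j, F i j = ∑ i, ∑ j ∈ Finset.Ioi i, (F i j + F j i) := by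
  have h1 : ∀ i j : Fin r, F i j = (if i < j then F i j else 0) + if j < i then F i j else 0 := by
    intro i j
    rcases lt_trichotomy i j with h | rfl | h
    · simp [h, h.not_gt]
    · simp [h0]
    · simp [h, h.not_gt]
  have h2 : ∑ i, ∑ j, (if j < i then F i j else 0) = ∑ i, ∑ j, if i < j then F j i else 0 :=
    Finset.sum_comm
  simp_rw [← Finset.filter_lt_eq_Ioi, Finset.sum_filter, ite_add_zero, Finset.sum_add_distrib]
  rw [← h2, ← Finset.sum_add_distrib]
  refine Finset.sum_congr rfl fun i _ => ?_
  rw [← Finset.sum_add_distrib]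
  exact Finset.sum_congr rfl fun j _ => h1 i j

/-- Bilinearity expands over all pairs of generators; the alternating property folds `(i, j)` and
`(j, i)` into a 2×2 minor. -/
theorem bracket_eq_sum (u v : FreeGroup (Fin r)) :
    bracket u v = ∑ i, ∑ j ∈ Finset.Ioi i, (incr u i * incr v j - incr u j * incr v i) •
      bracket (FreeGroup.of i) (FreeGroup.of j) := by
  rw [map_eq_sum_incr (fun u => bracket u v) (fun _ _ => bracket_mul_left _ _ _) u]
  have h : ∀ i, incr u i • bracket (FreeGroup.of i) v =
      ∑ j, (incr u i * incr v j) • bracket (FreeGroup.of i) (FreeGroup.of j) := by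
    intro i
    rw [map_eq_sum_incr (bracket (FreeGroup.of i)) (bracket_mul_right _) v, Finset.smul_sum]
    simp_rw [mul_smul]
  simp_rw [h]
  rw [sum_sum_eq_sum_Ioi _ fun i => by rw [bracket_self, smul_zero]]
  refine Finset.sum_congr rfl fun i _ => Finset.sum_congr rfl fun j _ => ?_
  rw [bracket_swap (FreeGroup.of i) (FreeGroup.of j), smul_neg, sub_smul, sub_eq_add_neg]

/-- Commutators die under each homomorphism `incr · i` to `ℤ`; conversely, the class in `H_1` is a
combination of generators with coefficients `incr g i`. -/
theorem mem_lcs_two_iff (g : FreeGroup (Fin r)) :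
    g ∈ lcs (FreeGroup (Fin r)) 2 ↔ ∀ i, incr g i = 0 := by
  constructor
  · intro hg i
    let φ : FreeGroup (Fin r) →* Multiplicative ℤ :=
      MonoidHom.mk' (fun g => .ofAdd (incr g i)) fun g h => by simp
    have h : lcs (FreeGroup (Fin r)) 2 ≤ φ.ker :=
      Subgroup.commutator_le.2 fun u _ v _ => by
        rw [MonoidHom.mem_ker, map_commutatorElement, commutatorElement_eq_one_iff_mul_comm,
          mul_comm]
    exact congrArg Multiplicative.toAdd (MonoidHom.mem_ker.1 (h hg))
  · intro h
    have h1 := map_eq_sum_incr (fun g => hcls 1 (⟨g, Subgroup.mem_top g⟩ : lcs _ 1))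
      (fun _ _ => rfl) g
    simp only [h, zero_smul, Finset.sum_const_zero] at h1
    exact (hcls_eq_zero_iff _).1 h1

-- Both claims are checked on commutators and propagate to products and inverses, since the cross
-- terms in the area vanish when the increments do.
open scoped commutatorElement in
theorem even_area_and_hcls_two (g : FreeGroup (Fin r)) (hg : g ∈ lcs (FreeGroup (Fin r)) 2) :
    (∀ i j, Even (area g i j)) ∧ hcls 2 ⟨g, hg⟩ = ∑ i, ∑ j ∈ Finset.Ioi i,
      (area g i j / 2) • bracket (FreeGroup.of i) (FreeGroup.of j) := by
  have hg' : g ∈ Subgroup.closure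
      {x | ∃ u ∈ (⊤ : Subgroup (FreeGroup (Fin r))), ∃ v ∈ (⊤ : Subgroup _), ⁅u, v⁆ = x} := hg
  induction hg' using Subgroup.closure_induction with
  | mem x hx =>
    obtain ⟨u, -, v, -, rfl⟩ := hx
    have ha : ∀ i j, area ⁅u, v⁆ i j = 2 * (incr u i * incr v j - incr u j * incr v i) := by
      intro i j
      simp [commutatorElement_def]
      ring
    refine ⟨fun i j => ha i j ▸ even_two_mul _, ?_⟩
    -- Mathlib's commutator is `u v u⁻¹ v⁻¹`, while `comm2` uses `u⁻¹ v⁻¹ u v`; the two sign changes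
    -- cancel in the minors.
    have h : hcls 2 ⟨⁅u, v⁆, hg⟩ = bracket u⁻¹ v⁻¹ := by
      rw [bracket]
      congr 1
      ext
      simp [comm2, commutatorElement_def]
    rw [h, bracket_eq_sum]
    refine Finset.sum_congr rfl fun i _ => Finset.sum_congr rfl fun j _ => ?_
    rw [ha, Int.mul_ediv_cancel_left _ two_ne_zero]
    simp
  | one =>
    refine ⟨fun i j => by simp, ?_⟩
    simp only [area_one, Int.zero_ediv, zero_smul, Finset.sum_const_zero]
    exact hcls_one 2
  | mul x y hx hy ihx ihy =>
    have hx : x ∈ lcs (FreeGroup (Fin r)) 2 := hx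
    have hy : y ∈ lcs (FreeGroup (Fin r)) 2 := hy
    obtain ⟨ex, sx⟩ := ihx hx
    obtain ⟨ey, sy⟩ := ihy hy
    have hx0 := (mem_lcs_two_iff x).1 hx
    have ha : ∀ i j, area (x * y) i j = area x i j + area y i j := by
      intro i j
      simp [hx0]
    refine ⟨fun i j => ha i j ▸ (ex i j).add (ey i j), ?_⟩
    refine (hcls_mul ⟨x, hx⟩ ⟨y, hy⟩).trans ?_
    rw [sx, sy, ← Finset.sum_add_distrib]
    refine Finset.sum_congr rfl fun i _ => ?_
    rw [← Finset.sum_add_distrib]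
    refine Finset.sum_congr rfl fun j _ => ?_
    -- Integer halving is additive here only because the areas are even, which is why parity is part
    -- of the same induction.
    rw [ha, Int.add_ediv_of_dvd_left (ex i j).two_dvd, add_smul]
  | inv x hx ih =>
    have hx' : x ∈ lcs (FreeGroup (Fin r)) 2 := hx
    obtain ⟨ex, sx⟩ := ih hx'
    refine ⟨fun i j => by rw [area_inv]; exact (ex i j).neg, ?_⟩
    refine (hcls_inv ⟨x, hx'⟩).trans ?_
    rw [sx, ← Finset.sum_neg_distrib]
    refine Finset.sum_congr rfl fun i _ => ?_
    rw [← Finset.sum_neg_distrib]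
    refine Finset.sum_congr rfl fun j _ => ?_
    rw [area_inv, Int.neg_ediv_of_dvd (ex i j).two_dvd, neg_smul]

/-- Antisymmetry is not built into `AreaGroup`; it holds on the image of the free group because
generators have zero area and the cross term is antisymmetric. -/
theorem area_swap (g : FreeGroup (Fin r)) (i j : Fin r) : area g j i = -area g i j := by
  induction g using FreeGroup.induction_on with
  | C1 => simp
  | of k => simp [area_of]
  | inv_of k => simp [area_of]
  | mul x y hx hy => rw [area_mul, area_mul, hx, hy]; ring

/-- Elements of `AreaGroup` with zero increment are central, so `incrArea` kills `[Γ^(2), Γ]`. The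
converse is the formula for `h_2`; no independence of the brackets is needed. -/
theorem mem_lcs_three_iff {g : FreeGroup (Fin r)} (hg : g ∈ lcs (FreeGroup (Fin r)) 2) :
    g ∈ lcs (FreeGroup (Fin r)) 3 ↔ ∀ i j, i < j → area g i j = 0 := by
  constructor
  · intro h i j _
    have hle : lcs (FreeGroup (Fin r)) 3 ≤ (incrArea (r := r)).ker :=
      Subgroup.commutator_le.2 fun u hu v _ => by
        have hu0 : ∀ i, (incrArea u).incr i = 0 := (mem_lcs_two_iff u).1 hu
        rw [MonoidHom.mem_ker, map_commutatorElement, commutatorElement_eq_one_iff_mul_comm]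
        ext <;> simp [hu0, add_comm]
    exact congrArg (AreaGroup.area · i j) (MonoidHom.mem_ker.1 (hle h))
  · intro h
    refine (hcls_eq_zero_iff ⟨g, hg⟩).1 ?_
    rw [(even_area_and_hcls_two g hg).2]
    refine Finset.sum_eq_zero fun i _ => Finset.sum_eq_zero fun j hj => ?_
    rw [h i j (Finset.mem_Ioi.1 hj), Int.zero_ediv, zero_smul]

/-! ### The signature up to order two -/

section Series

theorem NCSeries.one_apply (w : List (Fin r)) : (1 : NCSeries r) w = if w = [] then 1 else 0 := rfl

theorem NCSeries.mul_apply (f g : NCSeries r) (w : List (Fin r)) :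
    (f * g) w = ∑ k ∈ Finset.range (w.length + 1), f (w.take k) * g (w.drop k) := rfl

theorem NCSeries.sub_apply (f g : NCSeries r) (w : List (Fin r)) : (f - g) w = f w - g w := rfl

theorem NCSeries.smul_apply (c : ℝ) (f : NCSeries r) (w : List (Fin r)) :
    (c • f) w = c * f w := rfl

theorem NCSeries.sum_apply {ι : Type*} (s : Finset ι) (f : ι → NCSeries r) (w : List (Fin r)) :
    (∑ i ∈ s, f i) w = ∑ i ∈ s, f i w :=
  Finset.sum_apply w s f

theorem NCSeries.X_mul_X_apply (i j : Fin r) (w : List (Fin r)) :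
    (X i * X j : NCSeries r) w = if w = [i, j] then 1 else 0 := by
  rw [mul_apply]
  match w with
  | [] => simp [X]
  | [a] => simp [X, Finset.sum_range_succ]
  | [a, b] => by_cases h : a = i <;> by_cases h' : b = j <;> simp [X, Finset.sum_range_succ, h, h']
  | a :: b :: c :: w =>
    simp only [reduceCtorEq, List.cons.injEq, and_false, if_false]
    refine Finset.sum_eq_zero fun k _ => ?_
    rcases k with _ | _ | k <;> simp [X]

theorem NCSeries.expX_apply_nil (k : Fin r) (n : ℤ) : expX k n [] = 1 := by simp [expX]

theorem NCSeries.expX_apply_singleton (k : Fin r) (n : ℤ) (i : Fin r) :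
    expX k n [i] = n * (Pi.single k 1 : Fin r → ℤ) i := by
  by_cases h : i = k <;> simp [expX, h]

theorem NCSeries.expX_apply_pair (k : Fin r) (n : ℤ) (i j : Fin r) :
    expX k n [i, j] = n * (Pi.single k 1 : Fin r → ℤ) i *
      (n * (Pi.single k 1 : Fin r → ℤ) j) / 2 := by
  by_cases h : i = k <;> by_cases h' : j = k <;>
    simp [expX, h, h', List.replicate, sq]

/-- Arbitrary lists, not only reduced ones, make induction on the first letter possible. The
order-two coefficient of a product gains `s_i t_j`, which is half of the symmetric term `s_i t_j +
s_j t_i` plus half of the area term `s_i t_j - s_j t_i`. -/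
theorem prod_expX_apply (L : List (Fin r × Bool)) :
    let s := (L.map fun a => NCSeries.expX a.1 (if a.2 then 1 else -1)).prod
    s [] = 1 ∧ (∀ i, s [i] = incr (FreeGroup.mk L) i) ∧
      ∀ i j, s [i, j] = ((incr (FreeGroup.mk L) i : ℝ) * incr (FreeGroup.mk L) j +
        area (FreeGroup.mk L) i j) / 2 := by
  induction L with
  | nil =>
    rw [← FreeGroup.one_eq_mk]
    simp [NCSeries.one_apply]
  | cons a L ih =>
    obtain ⟨h0, h1, h2⟩ := ih
    have hmk : FreeGroup.mk (a :: L) = FreeGroup.mk [a] * FreeGroup.mk L := by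
      rw [FreeGroup.mul_mk]; rfl
    have hmk1 : FreeGroup.mk [a] = FreeGroup.of a.1 ∨ FreeGroup.mk [a] = (FreeGroup.of a.1)⁻¹ := by
      rcases a with ⟨k, _ | _⟩
      · exact .inr rfl
      · exact .inl rfl
    have hi : ∀ i, incr (FreeGroup.mk [a]) i =
        (if a.2 then 1 else -1) * (Pi.single a.1 1 : Fin r → ℤ) i := by
      rcases a with ⟨k, _ | _⟩
      · intro i
        change incr (FreeGroup.of k)⁻¹ i = _
        simp [incr_of]
      · intro i
        change incr (FreeGroup.of k) i = _
        simp [incr_of]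
    have ha : ∀ i j, area (FreeGroup.mk [a]) i j = 0 := by
      intro i j
      rcases hmk1 with h | h <;> simp [h, area_of]
    have e1 : ∀ i, NCSeries.expX a.1 (if a.2 then 1 else -1) [i] = incr (FreeGroup.mk [a]) i := by
      intro i
      rw [NCSeries.expX_apply_singleton, hi, Int.cast_mul]
    have e2 : ∀ i j, NCSeries.expX a.1 (if a.2 then 1 else -1) [i, j] =
        incr (FreeGroup.mk [a]) i * incr (FreeGroup.mk [a]) j / 2 := by
      intro i j
      rw [NCSeries.expX_apply_pair, hi, hi, Int.cast_mul, Int.cast_mul]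
    rw [hmk]
    simp only [List.map_cons, List.prod_cons, incr_mul, area_mul, ha]
    clear hmk
    refine ⟨?_, fun i => ?_, fun i j => ?_⟩
    · simp [NCSeries.mul_apply, NCSeries.expX_apply_nil, h0]
    · simp [NCSeries.mul_apply, Finset.sum_range_succ, NCSeries.expX_apply_nil, h0, h1, e1]
      ring
    · simp [NCSeries.mul_apply, Finset.sum_range_succ, NCSeries.expX_apply_nil, h0, h1, h2, e1, e2]
      ring

theorem signature_apply_nil (g : FreeGroup (Fin r)) : signature g [] = 1 :=
  (prod_expX_apply g.toWord).1

theorem signature_apply_singleton (g : FreeGroup (Fin r)) (i : Fin r) :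
    signature g [i] = incr g i := by
  have h := (prod_expX_apply g.toWord).2.1 i
  rwa [FreeGroup.mk_toWord] at h

theorem signature_apply_pair (g : FreeGroup (Fin r)) (i j : Fin r) :
    signature g [i, j] = ((incr g i : ℝ) * incr g j + area g i j) / 2 := by
  have h := (prod_expX_apply g.toWord).2.2 i j
  rwa [FreeGroup.mk_toWord] at h

/-- By antisymmetry, `c i j • [X_i, X_j]` is the sum of the `(i, j)` and `(j, i)` terms of `∑ c i j
• X_i X_j`. -/
theorem sum_smul_commutator_apply (c : Fin r → Fin r → ℝ) (hc : ∀ i j, c j i = -c i j)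
    (w : List (Fin r)) :
    (∑ i, ∑ j ∈ Finset.Ioi i, c i j •
      (NCSeries.X i * NCSeries.X j - NCSeries.X j * NCSeries.X i : NCSeries r)) w =
      ∑ i, ∑ j, if w = [i, j] then c i j else 0 := by
  rw [sum_sum_eq_sum_Ioi _ fun i => by
    have : c i i = 0 := by linarith [hc i i]
    simp [this]]
  simp only [NCSeries.sum_apply, NCSeries.smul_apply, NCSeries.sub_apply, NCSeries.X_mul_X_apply]
  refine Finset.sum_congr rfl fun i _ => Finset.sum_congr rfl fun j _ => ?_
  rw [hc i j]
  split_ifs <;> ring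

/-- A nonzero area is required: otherwise the terms of lowest degree would not be those of degree
two. -/
theorem lowestPoly_eq {g : FreeGroup (Fin r)} (h0 : ∀ i, incr g i = 0)
    (h : ∃ i j, i < j ∧ area g i j ≠ 0) :
    lowestPoly g = (1 / 2 : ℝ) • ∑ i : Fin r, ∑ j ∈ Finset.Ioi i, (area g i j : ℝ) •
      (NCSeries.X i * NCSeries.X j - NCSeries.X j * NCSeries.X i) := by
  have s0 : (signature g - 1) [] = 0 := by
    simp [NCSeries.sub_apply, signature_apply_nil, NCSeries.one_apply]
  have s1 : ∀ i, (signature g - 1) [i] = 0 := by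
    simp [NCSeries.sub_apply, signature_apply_singleton, NCSeries.one_apply, h0]
  have s2 : ∀ i j, (signature g - 1) [i, j] = area g i j / 2 := by
    simp [NCSeries.sub_apply, signature_apply_pair, NCSeries.one_apply, h0]
  funext w
  rw [NCSeries.smul_apply, sum_smul_commutator_apply _ fun i j => by rw [area_swap, Int.cast_neg]]
  rw [lowestPoly, NCSeries.lowest]
  match w with
  | [] => simp [s0]
  | [a] => simp [s1]
  | [a, b] =>
    have hv : ∀ v : List (Fin r), v.length < [a, b].length → (signature g - 1) v = 0 := by
      intro v hv
      match v with
      | [] => exact s0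
      | [k] => exact s1 k
      | _ :: _ :: _ => simp at hv
    rw [if_pos hv, s2]
    simp [ite_and]
    ring
  -- Words of length at least three are discarded, since the shorter word `[i, j]` has a nonzero
  -- coefficient.
  | a :: b :: c :: w =>
    obtain ⟨i, j, -, hij⟩ := h
    rw [if_neg]
    · simp
    · intro hv
      have := hv [i, j] (by simp)
      rw [s2] at this
      exact hij (by exact_mod_cast (div_eq_zero_iff.1 this).resolve_right two_ne_zero)

end Series

/-! ### Crossing numbers -/

section Crossings

/-- The number of pairs of positions `s < t` where `a` and `b` occur in a list. -/
def listCrossings {α : Type*} [DecidableEq α] (a b : α) : List α → ℕ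
  | [] => 0
  | d :: D => listCrossings a b D + if d = a then D.count b else 0

/-- As a double sum of indicators, the cardinality allows the first position to be split off, which
matches the recursion. -/
theorem natCard_pairs_eq_listCrossings {α : Type*} [DecidableEq α] (a b : α) (D : List α) :
    Nat.card {t : Fin D.length × Fin D.length //
      t.1 < t.2 ∧ D.get t.1 = a ∧ D.get t.2 = b} = listCrossings a b D := by
  have key : ∀ D : List α, Nat.card {t : Fin D.length × Fin D.length //
      t.1 < t.2 ∧ D.get t.1 = a ∧ D.get t.2 = b} = ∑ s : Fin D.length, ∑ t : Fin D.length,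
        if s < t ∧ D.get s = a ∧ D.get t = b then 1 else 0 := by
    intro D
    rw [Nat.card_eq_fintype_card, Fintype.card_subtype, Finset.card_filter,
      Fintype.sum_prod_type]
  have hcount : ∀ D : List α, (∑ t : Fin D.length, if D.get t = b then 1 else 0) = D.count b := by
    intro D
    induction D with
    | nil => rfl
    | cons d D ih =>
      rw [List.count_cons, ← ih]
      refine (Fin.sum_univ_succ _).trans ?_
      rw [add_comm]
      by_cases h : d = b <;> simp [h]
  rw [key]
  induction D with
  | nil => rfl
  | cons d D ih =>
    rw [listCrossings, ← ih, ← hcount]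
    refine (Fin.sum_univ_succ _).trans ?_
    rw [add_comm]
    congr 1
    · refine Finset.sum_congr rfl fun s _ => (Fin.sum_univ_succ _).trans ?_
      simp
    · refine (Fin.sum_univ_succ _).trans ?_
      by_cases h : d = a <;> simp [h]

end Crossings

/-! ### Increment and area of the word of a based loop. -/

namespace TreeFrame

variable {V : Type*} {G : SimpleGraph V} (B : TreeFrame G r)

open Classical in
theorem incr_letter (a : G.Dart) (i : Fin r) : incr (B.letter a) i =
    (if a = B.e i then 1 else 0) - (if a = (B.e i).symm then 1 else 0) := by
  rcases B.dart_cases a with h | ⟨k, rfl⟩ | ⟨k, rfl⟩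
  · have h1 : a ≠ B.e i := by
      rintro rfl
      exact B.edge_notMem i h
    have h2 : a ≠ (B.e i).symm := by
      rintro rfl
      exact B.edge_notMem i (by simpa using h)
    simp [B.letter_tree h, h1, h2]
  · rw [letter_e, incr_of]
    simp [B.e_ne_symm, Pi.single_apply, B.e_injective.eq_iff, eq_comm]
  · rw [letter_e_symm, incr_inv, incr_of]
    have : (B.e k).symm = (B.e i).symm ↔ k = i := by
      rw [Dart.symm_involutive.injective.eq_iff, B.e_injective.eq_iff]
    simp [(B.e_ne_symm _ _).symm, Pi.single_apply, this, eq_comm]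

theorem area_letter (a : G.Dart) (i j : Fin r) : area (B.letter a) i j = 0 := by
  rcases B.dart_cases a with h | ⟨k, rfl⟩ | ⟨k, rfl⟩
  · simp [B.letter_tree h]
  · simp [letter_e, area_of]
  · simp [letter_e_symm, area_of]

open Classical in
theorem incr_prod_letter (D : List G.Dart) (i : Fin r) : incr (D.map B.letter).prod i =
    (D.count (B.e i) : ℤ) - D.count (B.e i).symm := by
  induction D with
  | nil => simp
  | cons d D ih =>
    rw [List.map_cons, List.prod_cons, incr_mul, ih, incr_letter, List.count_cons, List.count_cons]
    simp only [beq_iff_eq]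
    push_cast
    ring

-- Prepending `d` adds the cross term of `incr (B.letter d)` with the signed counts in `D`, which is
-- what the recursion for `listCrossings` adds to the signed crossing numbers.
open Classical in
theorem area_prod_letter (D : List G.Dart) (i j : Fin r) : area (D.map B.letter).prod i j =
    ((listCrossings (B.e i) (B.e j) D + listCrossings (B.e i).symm (B.e j).symm D
      - listCrossings (B.e i) (B.e j).symm D - listCrossings (B.e i).symm (B.e j) D : ℤ)) -
    (listCrossings (B.e j) (B.e i) D + listCrossings (B.e j).symm (B.e i).symm D
      - listCrossings (B.e j) (B.e i).symm D - listCrossings (B.e j).symm (B.e i) D) := by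
  induction D with
  | nil => simp [listCrossings]
  | cons d D ih =>
    rw [List.map_cons, List.prod_cons, area_mul, ih, incr_letter, incr_letter, incr_prod_letter,
      incr_prod_letter, area_letter]
    simp only [listCrossings]
    push_cast
    split_ifs <;> ring

theorem area_elt (b : BasedLoop G) (i j : Fin r) :
    area (B.elt b) i j = B.crossN b i j - B.crossN b j i := by
  rw [elt_eq_word, word, area_prod_letter]
  simp only [crossN, BasedLoop.crossings, ← natCard_pairs_eq_listCrossings]

theorem conjClass_of_represents {b : BasedLoop G} {l : Loop G} (h : b.Represents l) :
    B.conjClass l = ConjClasses.mk (B.elt b) := by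
  subst h
  rfl

theorem loopH_eq {n : ℕ} {b : BasedLoop G} {l : Loop G} (h : n ≤ B.loopDegree l)
    (hb : b.Represents l) : B.loopH n l h = hcls n
      ⟨B.elt b, mem_lcs_of_le_degree h (B.conjClass_of_represents hb).symm⟩ :=
  hclass_eq h (B.conjClass_of_represents hb).symm

end TreeFrame

end GraphLoops

/-! ### Assembly of the three statements. -/

open GraphLoops in
theorem proposition2 {V : Type*} [Finite V] {G : SimpleGraph V} {r : ℕ} (B : TreeFrame G r)
    (l : Loop G) :
    -- `h_1(l) = 0` means `d(l) ≥ 2`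
    (B.loopH 1 l (one_le_degree _) = 0 ↔ 2 ≤ B.loopDegree l) ∧
    (B.loopH 1 l (one_le_degree _) = 0 →
      (∀ b b' : BasedLoop G, b.Represents l → b'.Represents l → ∀ i j : Fin r, i < j →
        B.crossN b i j - B.crossN b j i = B.crossN b' i j - B.crossN b' j i) ∧
      (∀ b : BasedLoop G, b.Represents l →
        ((∀ i j : Fin r, i < j → B.crossN b i j - B.crossN b j i = 0) ↔ 2 < B.loopDegree l))) ∧
    (B.loopDegree l = 2 → ∀ b : BasedLoop G, b.Represents l →
      ∀ g ∈ (B.conjClass l).carrier,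
        lowestPoly g = (1 / 2 : ℝ) • ∑ i : Fin r, ∑ j ∈ Finset.Ioi i,
          ((B.crossN b i j - B.crossN b j i : ℤ) : ℝ) •
            (NCSeries.X i * NCSeries.X j - NCSeries.X j * NCSeries.X i)) ∧
    (∀ h2 : ((2 : ℕ) : ℕ∞) ≤ B.loopDegree l, ∀ b : BasedLoop G, b.Represents l →
      (∀ i j : Fin r, i < j → Even (B.crossN b i j - B.crossN b j i)) ∧
      B.loopH 2 l h2 = ∑ i : Fin r, ∑ j ∈ Finset.Ioi i,
        ((B.crossN b i j - B.crossN b j i) / 2) •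
          hcls 2 (comm2 (FreeGroup.of i) (FreeGroup.of j))) := by
  -- Every condition on the degree becomes membership of the word of a based loop in a term of the
  -- lower central series.
  have hdeg : ∀ {n : ℕ}, 1 ≤ n → ∀ {b : BasedLoop G}, b.Represents l →
      ((n : ℕ∞) ≤ B.loopDegree l ↔ B.elt b ∈ lcs (FreeGroup (Fin r)) n) := by
    intro n hn b hb
    rw [TreeFrame.loopDegree, B.conjClass_of_represents hb, natCast_le_degree_mk hn]
  have hthree : 2 < B.loopDegree l ↔ ((3 : ℕ) : ℕ∞) ≤ B.loopDegree l := by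
    have : ((3 : ℕ) : ℕ∞) = 2 + 1 := rfl
    rw [this, ENat.add_one_le_iff (by simp)]
  have hlt : ∀ {b : BasedLoop G}, b.Represents l → 2 ≤ B.loopDegree l →
      ((∀ i j : Fin r, i < j → B.crossN b i j - B.crossN b j i = 0) ↔ 2 < B.loopDegree l) := by
    intro b hb h
    rw [hthree, hdeg (by norm_num) hb, mem_lcs_three_iff ((hdeg one_le_two hb).1 h)]
    simp only [B.area_elt]
  have hzero : ∀ {b : BasedLoop G}, b.Represents l → 2 ≤ B.loopDegree l →
      ∀ i, incr (B.elt b) i = 0 := fun hb h =>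
    (mem_lcs_two_iff _).1 ((hdeg one_le_two hb).1 h)
  have hone : B.loopH 1 l (one_le_degree _) = 0 ↔ 2 ≤ B.loopDegree l := by
    obtain ⟨b, hb⟩ := Quot.exists_rep l
    have hb' : b.Represents l := hb
    rw [show B.loopH 1 l (one_le_degree _) = _ from B.loopH_eq _ hb', hcls_eq_zero_iff]
    exact (hdeg one_le_two hb').symm
  refine ⟨hone, fun h => ⟨fun b b' hb hb' i j _ => ?_, fun b hb => hlt hb (hone.1 h)⟩,
    fun h b hb g hg => ?_, fun h2 b hb => ⟨fun i j _ => ?_, ?_⟩⟩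
  · rw [← B.area_elt, ← B.area_elt]
    refine area_eq_of_isConj ?_ (hzero hb' (hone.1 h)) i j
    rw [← ConjClasses.mk_eq_mk_iff_isConj, ← B.conjClass_of_represents hb',
      B.conjClass_of_represents hb]
  · have hconj : IsConj (B.elt b) g := by
      rw [ConjClasses.mem_carrier_iff_mk_eq, B.conjClass_of_represents hb] at hg
      exact ConjClasses.mk_eq_mk_iff_isConj.1 hg.symm
    have h0 := hzero hb h.ge
    have ha := area_eq_of_isConj hconj h0
    -- If all areas vanished, the degree would exceed two.
    have hne : ∃ i j, i < j ∧ area g i j ≠ 0 := by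
      by_contra! hcon
      refine ((hlt hb h.ge).1 fun i j hij => ?_).ne' h
      rw [← B.area_elt, ← ha, hcon i j hij]
    rw [lowestPoly_eq (fun i => (incr_eq_of_isConj hconj i).trans (h0 i)) hne]
    simp only [ha, B.area_elt]
  · rw [← B.area_elt]
    exact (even_area_and_hcls_two _ ((hdeg one_le_two hb).1 h2)).1 i j
  · rw [B.loopH_eq _ hb, (even_area_and_hcls_two _ _).2]
    simp only [B.area_elt, bracket]
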